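/- Let $d\ge 2$, $m\ge 0$ be integers and let $\sigma:\mathbb R\to\mathbb R$ be a Lipschitz activation function that is non-linear, meaning that $\sigma$ is not of the form $x\mapsto ax+c$. Consider the continuous-time ResNet on $\mathbb R^d$ with control family $$\mathcal F=\{x\mapsto W\sigma(Ax+b)\mid W,A\in\mathbb R^{d\times d},\ b\in\mathbb R^d\},$$ where $\sigma$ is applied to each coordinate. For $f\in\mathcal F$ and $t\ge 0$ let $\varphi^f_t:\mathbb R^d\to\mathbb R^d$ be the flow map $x(0)\mapsto x(t)$ of $\dot x=f(x)$, and let $$\mathcal A_{\mathcal F}=\{\varphi^{f_k}_{t_k}\circ\cdots\circ\varphi^{f_1}_{t_1}\mid k\ge 1,\ f_1,\dots,f_k\in\mathcal F,\ t_1,\dots,t_k\ge 0\}$$ be the attainable set (all flow maps of the system with piecewise constant controls in finite time). Let $\mathcal G$ be a family of Lipschitz maps $\mathbb R^d\to\mathbb R^m$ (the terminal family) and let $F:\mathbb R^d\to\mathbb R^m$ be continuous. Suppose that for every compact set $K\subseteq\mathbb R^d$ there exists $g\in\mathcal G$ with $F(K)\subseteq g(\mathbb R^d)$. Then for every compact set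 $K\subseteq\mathbb R^d$, every $\varepsilon>0$ and every $p\in[1,\infty)$ there exist $\varphi\in\mathcal A_{\mathcal F}$ and $g\in\mathcal G$ such that $$\|F-g\circ\varphi\|_{L^p(K)}<\varepsilon .$$ -/

import Mathlib

open MeasureTheory
open scoped ENNReal Matrix

namespace CTResNet

/-- The right-hand side `x ↦ W σ(A x + b)` of a continuous-time ResNet on `ℝ^d`, with the scalar
activation `σ` applied to each coordinate. -/
def field {d : ℕ} (σ : ℝ → ℝ) (W A : Matrix (Fin d) (Fin d) ℝ) (b : EuclideanSpace ℝ (Fin d)) :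
    EuclideanSpace ℝ (Fin d) → EuclideanSpace ℝ (Fin d) :=
  fun x => WithLp.toLp 2 (W *ᵥ fun i => σ ((A *ᵥ x.ofLp) i + b i))

/-- The control family of the continuous-time ResNet with activation `σ` on `ℝ^d`. -/
def controlFamily (d : ℕ) (σ : ℝ → ℝ) :
    Set (EuclideanSpace ℝ (Fin d) → EuclideanSpace ℝ (Fin d)) :=
  {f | ∃ (W A : Matrix (Fin d) (Fin d) ℝ) (b : EuclideanSpace ℝ (Fin d)), f = field σ W A b}

/-- `φ` is the time-`t` flow map of the autonomous equation `ẋ = f(x)`: every `x₀` is the initial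
value of a solution on `[0, t]`, and `φ x₀` is the value at time `t` of that solution.
(For Lipschitz `f` and `t ≥ 0` there is exactly one such `φ`.) -/
def IsFlowMap {E : Type*} [NormedAddCommGroup E] [NormedSpace ℝ E]
    (f : E → E) (t : ℝ) (φ : E → E) : Prop :=
  ∀ x₀ : E, ∃ x : ℝ → E, x 0 = x₀ ∧
    (∀ s ∈ Set.Icc 0 t, HasDerivWithinAt x (f (x s)) (Set.Icc 0 t) s) ∧ φ x₀ = x t

/-- `IsFlow 𝓕 T φ`: `φ` is a composition of `k ≥ 1` flow maps of members of `𝓕`, run for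
non-negative times with sum `T`, i.e. `φ` is the time-`T` flow map of a piecewise constant
control. -/
inductive IsFlow {E : Type*} [NormedAddCommGroup E] [NormedSpace ℝ E] (𝓕 : Set (E → E)) :
    ℝ → (E → E) → Prop
  | single {f : E → E} {t : ℝ} {φ : E → E} :
      f ∈ 𝓕 → 0 ≤ t → IsFlowMap f t φ → IsFlow 𝓕 t φ
  | comp {f : E → E} {s t : ℝ} {φ ψ : E → E} :
      IsFlow 𝓕 s ψ → f ∈ 𝓕 → 0 ≤ t → IsFlowMap f t φ → IsFlow 𝓕 (s + t) (φ ∘ ψ)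

/-- The attainable set of time horizon `T`: all flow maps of piecewise constant controls with
total time in `[0, T]`. -/
def attainableSetWithin {E : Type*} [NormedAddCommGroup E] [NormedSpace ℝ E]
    (𝓕 : Set (E → E)) (T : ℝ) : Set (E → E) :=
  ⋃ t ∈ Set.Icc 0 T, {φ | IsFlow 𝓕 t φ}

/-- The (total) attainable set of the control family `𝓕`. -/
def attainableSet {E : Type*} [NormedAddCommGroup E] [NormedSpace ℝ E]
    (𝓕 : Set (E → E)) : Set (E → E) :=
  ⋃ T ∈ Set.Ici (0 : ℝ), attainableSetWithin 𝓕 T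

/-- A scalar function is affine; an activation function is called non-linear if it is not. -/
def IsAffine (σ : ℝ → ℝ) : Prop := ∃ a c : ℝ, ∀ x, σ x = a * x + c

end CTResNet

/-! The target is a discontinuous map: cut `K` into small cells, and send each cell to a point whose
image under `g` is a value of `F` on that cell; such a point exists because `g` covers `F '' K`.
This map depends on `x` only through the integer number of its cell, so it factors through a curve
in `ℝ^d`, and the flow only has to compute that number and then read off the curve.

Continuous maps that are limits of attainable maps, uniformly on compact sets, are closed under
composition (`comp_mem_approxAttainable`). Two kinds suffice. Shears `x_i ↦ x_i + h (x_j)`, `i ≠ j`: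
a field `c σ(a x_j + b) e_i` leaves `x_j` fixed, so its flow is a shear, and the functions `σ(a t +
b)` span a dense set of continuous functions (`continuous_mem_localClosure`). Projections `x_i ↦ 0`:
near a point where `σ` has nonzero derivative, a difference of two neurons gives a contracting
scalar field (`proj_mem_approxAttainable`). Together they overwrite `x_i` by any continuous function
of `x_j`.

Base-`B` digits of the other coordinates are then added to `x_i`, the others are overwritten by
functions of `x_i`, and finally `x_i` by a function of `x_j` (`curve_mem_approxAttainable`). Floors
are replaced by continuous staircases that converge pointwise and stay bounded, so
`exists_bounded_approximation` and dominated convergence yield the `L^p` bound. -/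

namespace CTResNet

/-! ### Density of ridge functions in one variable -/

/-- The functions that are limits, uniformly on bounded sets, of members of `V`. -/
def localClosure (V : Submodule ℝ (ℝ → ℝ)) : Submodule ℝ (ℝ → ℝ) where
  carrier := {f | ∀ R ε : ℝ, 0 < ε → ∃ g ∈ V, ∀ t, |t| ≤ R → |f t - g t| ≤ ε}
  zero_mem' := fun R ε hε => ⟨0, V.zero_mem, fun t _ => by simpa using hε.le⟩
  add_mem' := by
    intro f f' hf hf' R ε hε
    obtain ⟨g, hg, h⟩ := hf R (ε / 2) (half_pos hε)
    obtain ⟨g', hg', h'⟩ := hf' R (ε / 2) (half_pos hε)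
    refine ⟨g + g', V.add_mem hg hg', fun t ht => ?_⟩
    have h1 := h t ht
    have h2 := h' t ht
    rw [abs_le] at *
    simp only [Pi.add_apply]
    constructor <;> linarith
  smul_mem' := by
    intro c f hf R ε hε
    obtain ⟨g, hg, h⟩ := hf R (ε / (|c| + 1)) (by positivity)
    refine ⟨c • g, V.smul_mem c hg, fun t ht => ?_⟩
    have h1 := h t ht
    rw [le_div_iff₀ (by positivity)] at h1
    have : |c * f t - c * g t| = |f t - g t| * |c| := by
      rw [← mul_sub, abs_mul, mul_comm]
    simp only [Pi.smul_apply, smul_eq_mul, this]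
    nlinarith [abs_nonneg (f t - g t)]

theorem le_localClosure (V : Submodule ℝ (ℝ → ℝ)) : V ≤ localClosure V :=
  fun f hf _ _ hε => ⟨f, hf, fun t _ => by simpa using hε.le⟩

theorem localClosure_localClosure_le (V : Submodule ℝ (ℝ → ℝ)) :
    localClosure (localClosure V) ≤ localClosure V := by
  intro f hf R ε hε
  obtain ⟨g, hg, h⟩ := hf R (ε / 2) (half_pos hε)
  obtain ⟨k, hk, h'⟩ := hg R (ε / 2) (half_pos hε)
  refine ⟨k, hk, fun t ht => ?_⟩
  have := abs_sub_le (f t) (g t) (k t)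
  linarith [h t ht, h' t ht]

/-- The linear span of the functions `t ↦ σ (a t + b)`. -/
def ridgeSpan (σ : ℝ → ℝ) : Submodule ℝ (ℝ → ℝ) :=
  Submodule.span ℝ (Set.range fun (p : ℝ × ℝ) t => σ (p.1 * t + p.2))

theorem ridgeSpan_comp_affine {σ g : ℝ → ℝ} (hg : g ∈ ridgeSpan σ) (a b : ℝ) :
    (fun t => g (a * t + b)) ∈ ridgeSpan σ := by
  induction hg using Submodule.span_induction with
  | mem x h =>
    obtain ⟨p, rfl⟩ := h
    refine Submodule.subset_span ⟨(p.1 * a, p.1 * b + p.2), ?_⟩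
    funext t
    simp only
    congr 1
    ring
  | zero => exact Submodule.zero_mem _
  | add x y _ _ hx hy => exact Submodule.add_mem _ hx hy
  | smul c x _ hx => exact Submodule.smul_mem _ c hx

theorem localClosure_comp_affine {σ f : ℝ → ℝ} (hf : f ∈ localClosure (ridgeSpan σ)) (a b : ℝ) :
    (fun t => f (a * t + b)) ∈ localClosure (ridgeSpan σ) := by
  intro R ε hε
  obtain ⟨g, hg, h⟩ := hf (|a| * R + |b|) ε hε
  refine ⟨_, ridgeSpan_comp_affine hg a b, fun t ht => h _ ?_⟩
  calc |a * t + b| ≤ |a * t| + |b| := abs_add_le _ _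
    _ ≤ |a| * R + |b| := by rw [abs_mul]; gcongr

/-- The moving integral `t ↦ ∫₀ʰ f (t + s) ds`. -/
noncomputable def movingIntegral (h : ℝ) (f : ℝ → ℝ) (t : ℝ) : ℝ := ∫ s in (0 : ℝ)..h, f (t + s)

theorem hasDerivAt_movingIntegral {f : ℝ → ℝ} (hf : Continuous f) (h t : ℝ) :
    HasDerivAt (movingIntegral h f) (fwdDiff h f t) t := by
  have h1 : movingIntegral h f =
      fun t => (∫ s in (0 : ℝ)..(t + h), f s) - ∫ s in (0 : ℝ)..t, f s := by
    funext t
    rw [movingIntegral, intervalIntegral.integral_comp_add_left f t, add_zero,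
      intervalIntegral.integral_interval_sub_left] <;> exact hf.intervalIntegrable _ _
  rw [h1]
  have key : ∀ u, HasDerivAt (fun u => ∫ s in (0 : ℝ)..u, f s) (f u) u := fun u =>
    intervalIntegral.integral_hasDerivAt_right (hf.intervalIntegrable _ _)
      (hf.stronglyMeasurableAtFilter _ _) hf.continuousAt
  exact ((key (t + h)).comp_add_const t h).sub (key t)

theorem lipschitzWith_movingIntegral {f : ℝ → ℝ} {L : NNReal} (hf : LipschitzWith L f) (h : ℝ) :
    LipschitzWith (L * ‖h‖₊) (movingIntegral h f) := by
  refine LipschitzWith.of_dist_le_mul fun x y => ?_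
  have hi : ∀ t, IntervalIntegrable (fun s => f (t + s)) volume 0 h := fun t =>
    (hf.continuous.comp (by fun_prop : Continuous fun s => t + s)).intervalIntegrable _ _
  rw [Real.dist_eq, movingIntegral, movingIntegral, ← intervalIntegral.integral_sub (hi x) (hi y)]
  have := intervalIntegral.norm_integral_le_of_norm_le_const (a := 0) (b := h)
    (f := fun s => f (x + s) - f (y + s)) (C := L * |x - y|) (fun s _ => by
      have := hf.dist_le_mul (x + s) (y + s)
      simpa [Real.dist_eq] using this)
  simp only [sub_zero, Real.norm_eq_abs] at this
  simpa [Real.dist_eq, mul_right_comm] using this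

/-- Each moving integral gains one derivative, and differentiating it returns a forward difference.
This smooths `σ` while keeping its top derivative explicit. -/
theorem iterate_movingIntegral (h : ℝ) {f : ℝ → ℝ} (hf : Continuous f) (k : ℕ) :
    ContDiff ℝ k ((movingIntegral h)^[k] f) ∧
      iteratedDeriv k ((movingIntegral h)^[k] f) = (fwdDiff h)^[k] f := by
  induction k with
  | zero => simpa using hf
  | succ k ih =>
    obtain ⟨ih1, ih2⟩ := ih
    set g := (movingIntegral h)^[k] f with hg
    have hd : deriv (movingIntegral h g) = fun t => g (t + h) - g t := by
      funext t
      exact (hasDerivAt_movingIntegral ih1.continuous h t).deriv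
    have hsh : ContDiff ℝ k fun t => g (t + h) := ih1.comp (contDiff_id.add contDiff_const)
    rw [Function.iterate_succ_apply', Function.iterate_succ_apply', ← hg, iteratedDeriv_succ', hd]
    constructor
    · have : ((k + 1 : ℕ) : WithTop ℕ∞) = (k : WithTop ℕ∞) + 1 := by norm_cast
      rw [this, contDiff_succ_iff_deriv]
      refine ⟨fun t => (hasDerivAt_movingIntegral ih1.continuous h t).differentiableAt, ?_, ?_⟩
      · intro h'
        simp at h'
      · rw [hd]
        exact hsh.sub ih1
    · funext t
      rw [iteratedDeriv_fun_sub hsh.contDiffAt ih1.contDiffAt, iteratedDeriv_comp_add_const, ih2]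
      rfl

/-- Riemann sums of the integral are combinations of translates of `f`; the Lipschitz bound makes
their error at most `L h² / N`, uniformly in `t`. -/
theorem movingIntegral_mem {σ f : ℝ → ℝ} {L : NNReal} (hL : LipschitzWith L f)
    (hf : f ∈ localClosure (ridgeSpan σ)) (h : ℝ) :
    movingIntegral h f ∈ localClosure (ridgeSpan σ) := by
  refine localClosure_localClosure_le _ fun R ε hε => ?_
  obtain ⟨N, hN⟩ := exists_nat_gt (L * |h| * |h| / ε)
  have hN0 : (0 : ℝ) < N := lt_of_le_of_lt (by positivity) hN
  refine ⟨∑ i ∈ Finset.range N, (h / N) • fun t => f (1 * t + (i : ℝ) * (h / N)),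
    Submodule.sum_mem _ fun i _ => Submodule.smul_mem _ _ (localClosure_comp_affine hf _ _), ?_⟩
  intro t _
  have hc : Continuous fun s => f (t + s) := hL.continuous.comp (by fun_prop)
  have hsum := intervalIntegral.sum_integral_adjacent_intervals (μ := volume)
    (f := fun s => f (t + s)) (a := fun i : ℕ => (i : ℝ) * (h / N)) (n := N)
    (fun k _ => hc.intervalIntegrable _ _)
  have hend : (N : ℝ) * (h / N) = h := by field_simp
  simp only [Nat.cast_zero, zero_mul, hend] at hsum
  have hterm : ∀ i : ℕ, |(∫ s in ((i : ℝ) * (h / N))..(((i + 1 : ℕ) : ℝ) * (h / N)), f (t + s)) -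
      (h / N) * f (t + (i : ℝ) * (h / N))| ≤ L * (|h| / N) * (|h| / N) := by
    intro i
    have hlen : ((i + 1 : ℕ) : ℝ) * (h / N) - (i : ℝ) * (h / N) = h / N := by push_cast; ring
    have hconst : (h / N) * f (t + (i : ℝ) * (h / N)) =
        ∫ s in ((i : ℝ) * (h / N))..(((i + 1 : ℕ) : ℝ) * (h / N)), f (t + (i : ℝ) * (h / N)) := by
      rw [intervalIntegral.integral_const, hlen, smul_eq_mul]
    rw [hconst, ← intervalIntegral.integral_sub (hc.intervalIntegrable _ _) (by simp)]
    have hle := intervalIntegral.norm_integral_le_of_norm_le_const (C := L * (|h| / N))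
      (a := (i : ℝ) * (h / N)) (b := ((i + 1 : ℕ) : ℝ) * (h / N))
      (f := fun s => f (t + s) - f (t + (i : ℝ) * (h / N))) ?_
    · rwa [hlen, abs_div, Nat.abs_cast] at hle
    · intro s hs
      have h1 := hL.dist_le_mul (t + s) (t + (i : ℝ) * (h / N))
      rw [Real.dist_eq, Real.dist_eq] at h1
      refine h1.trans ?_
      gcongr
      have h2 := Set.abs_sub_left_of_mem_uIcc (Set.uIoc_subset_uIcc hs)
      rw [hlen, abs_div, Nat.abs_cast] at h2
      rwa [add_sub_add_left_eq_sub]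
  rw [movingIntegral, ← hsum]
  simp only [Finset.sum_apply, Pi.smul_apply, smul_eq_mul, one_mul]
  rw [← Finset.sum_sub_distrib]
  refine (Finset.abs_sum_le_sum_abs _ _).trans ((Finset.sum_le_sum fun i _ => hterm i).trans ?_)
  rw [Finset.sum_const, Finset.card_range, nsmul_eq_mul]
  rw [div_lt_iff₀ hε] at hN
  have : (N : ℝ) * (L * (|h| / N) * (|h| / N)) = L * |h| * |h| / N := by field_simp
  rw [this, div_le_iff₀ hN0]
  linarith

theorem iterate_movingIntegral_mem {σ : ℝ → ℝ} (hσ : ∃ L, LipschitzWith L σ) (h : ℝ) (k : ℕ) :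
    (∃ L, LipschitzWith L ((movingIntegral h)^[k] σ)) ∧
      (movingIntegral h)^[k] σ ∈ localClosure (ridgeSpan σ) := by
  induction k with
  | zero =>
    refine ⟨hσ, le_localClosure _ (Submodule.subset_span ⟨(1, 0), ?_⟩)⟩
    funext t
    simp
  | succ k ih =>
    obtain ⟨⟨L, hL⟩, hm⟩ := ih
    rw [Function.iterate_succ_apply']
    exact ⟨⟨_, lipschitzWith_movingIntegral hL h⟩, movingIntegral_mem hL hm h⟩

/-- If a `k`-th derivative of a member does not vanish and the lower monomials are members, then so
is the `k`-th monomial. -/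
theorem pow_mem_of_iteratedDeriv_ne_zero {σ f : ℝ → ℝ} {k : ℕ} {b : ℝ}
    (hf : f ∈ localClosure (ridgeSpan σ)) (hd : ContDiff ℝ k f) (hb : iteratedDeriv k f b ≠ 0)
    (hlow : ∀ i < k, (fun t : ℝ => t ^ i) ∈ localClosure (ridgeSpan σ)) :
    (fun t : ℝ => t ^ k) ∈ localClosure (ridgeSpan σ) := by
  set D := iteratedDeriv k f b
  have hmain : (fun t : ℝ => D / k.factorial * t ^ k) ∈ localClosure (ridgeSpan σ) := by
    refine localClosure_localClosure_le _ fun R ε hε => ?_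
    set M := |R| + 1
    have hM : 0 < M := by positivity
    -- Zooming in at `b`: once the terms of order below `k` are removed, `f (a t + b) / a ^ k` tends
    -- to `D / k! * t ^ k` as `a → 0`. The constant `c` makes the Peano remainder at most `a ^ k *
    -- ε` for `|t| ≤ M`.
    have hT := (taylor_isLittleO_univ (x₀ := b) hd).def (c := ε / M ^ k) (by positivity)
    rw [Metric.eventually_nhds_iff] at hT
    obtain ⟨δ, hδ, hT⟩ := hT
    set a := δ / (2 * M)
    have ha : 0 < a := by positivity
    refine ⟨(a ^ k)⁻¹ • ((fun t => f (a * t + b)) - ∑ i ∈ Finset.range k,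
      ((i.factorial : ℝ)⁻¹ * a ^ i * iteratedDeriv i f b) • fun t : ℝ => t ^ i), ?_, ?_⟩
    · refine Submodule.smul_mem _ _ (Submodule.sub_mem _ (localClosure_comp_affine hf a b)
        (Submodule.sum_mem _ fun i hi => Submodule.smul_mem _ _ (hlow i (Finset.mem_range.1 hi))))
    · intro t ht
      have htM : |t| ≤ M := ht.trans ((le_abs_self R).trans (by simp [M]))
      have h1 : dist (a * t + b) b < δ := by
        rw [Real.dist_eq, add_sub_cancel_right, abs_mul, abs_of_pos ha]
        calc a * |t| ≤ a * M := by gcongr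
          _ = δ / 2 := by simp only [a]; field_simp
          _ < δ := by linarith
      have h2 := hT h1
      rw [taylor_within_apply, Finset.sum_range_succ, add_sub_cancel_right] at h2
      simp only [iteratedDerivWithin_univ, Real.norm_eq_abs, smul_eq_mul] at h2
      have h3 : D / k.factorial * t ^ k - (a ^ k)⁻¹ * (f (a * t + b) - ∑ i ∈ Finset.range k,
          ((i.factorial : ℝ)⁻¹ * a ^ i * iteratedDeriv i f b) * t ^ i) =
          -((a ^ k)⁻¹ * (f (a * t + b) - (∑ i ∈ Finset.range k,
          (i.factorial : ℝ)⁻¹ * (a * t) ^ i * iteratedDeriv i f b +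
          (k.factorial : ℝ)⁻¹ * (a * t) ^ k * D))) := by
        have : ∑ i ∈ Finset.range k, ((i.factorial : ℝ)⁻¹ * a ^ i * iteratedDeriv i f b) * t ^ i =
            ∑ i ∈ Finset.range k, (i.factorial : ℝ)⁻¹ * (a * t) ^ i * iteratedDeriv i f b :=
          Finset.sum_congr rfl fun i _ => by rw [mul_pow]; ring
        rw [this]
        have hak : a ^ k ≠ 0 := by positivity
        field_simp
        ring
      simp only [Pi.smul_apply, Pi.sub_apply, Finset.sum_apply, smul_eq_mul]
      rw [h3, abs_neg, abs_mul, abs_of_pos (by positivity : 0 < (a ^ k)⁻¹)]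
      rw [inv_mul_le_iff₀ (by positivity)]
      refine h2.trans ?_
      rw [abs_pow, abs_mul, abs_of_pos ha, mul_pow]
      calc ε / M ^ k * (a ^ k * |t| ^ k) ≤ ε / M ^ k * (a ^ k * M ^ k) := by gcongr
        _ = a ^ k * ε := by field_simp
  have := Submodule.smul_mem _ (k.factorial / D) hmain
  convert this using 1
  funext t
  have : (k.factorial : ℝ) ≠ 0 := by positivity
  simp only [Pi.smul_apply, smul_eq_mul]
  field_simp

/-- A Lipschitz function with a vanishing difference of some order has vanishing second
difference. -/
theorem fwdDiff_two_eq_zero {σ : ℝ → ℝ} {L : NNReal} (hσ : LipschitzWith L σ) (h : ℝ) (k : ℕ)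
    (hk : (fwdDiff h)^[k] σ = 0) : (fwdDiff h)^[2] σ = 0 := by
  have hz : fwdDiff h (0 : ℝ → ℝ) = 0 := by funext t; simp [fwdDiff]
  have hbdd : ∀ j, ∃ C, ∀ t, |(fwdDiff h)^[j + 1] σ t| ≤ C := by
    intro j
    induction j with
    | zero =>
      refine ⟨L * |h|, fun t => ?_⟩
      simpa [fwdDiff, Real.dist_eq] using hσ.dist_le_mul (t + h) t
    | succ j ih =>
      obtain ⟨C, hC⟩ := ih
      refine ⟨C + C, fun t => ?_⟩
      rw [Function.iterate_succ_apply']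
      exact (abs_sub _ _).trans (add_le_add (hC _) (hC _))
  -- Differences of order at least one are bounded. If the next-but-one difference of `τ` vanishes,
  -- `τ` runs through an arithmetic progression along `t + n h`; being bounded, it has step zero.
  -- The descent stops at order two because `σ` itself need not be bounded.
  have hstep : ∀ j, (fwdDiff h)^[j + 3] σ = 0 → (fwdDiff h)^[j + 2] σ = 0 := by
    intro j hj
    obtain ⟨C, hC⟩ := hbdd j
    set τ := (fwdDiff h)^[j + 1] σ with hτ
    have h2 : (fwdDiff h)^[j + 2] σ = fwdDiff h τ := Function.iterate_succ_apply' _ _ _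
    rw [Function.iterate_succ_apply', h2] at hj
    rw [h2]
    funext t
    have hper : ∀ n : ℕ, fwdDiff h τ (t + n * h) = fwdDiff h τ t := by
      intro n
      induction n with
      | zero => simp
      | succ n ih =>
        have := congrFun hj (t + n * h)
        rw [fwdDiff, Pi.zero_apply, sub_eq_zero] at this
        rw [← ih, ← this]
        congr 1
        push_cast
        ring
    have hlin : ∀ n : ℕ, τ (t + n * h) = τ t + n * fwdDiff h τ t := by
      intro n
      induction n with
      | zero => simp
      | succ n ih =>
        have := hper n
        rw [fwdDiff] at this
        have e : t + ((n + 1 : ℕ) : ℝ) * h = t + n * h + h := by push_cast; ring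
        rw [e]
        push_cast
        linarith
    by_contra hne
    have hpos : 0 < |fwdDiff h τ t| := abs_pos.2 hne
    obtain ⟨n, hn⟩ := exists_nat_gt (2 * C / |fwdDiff h τ t|)
    rw [div_lt_iff₀ hpos] at hn
    have h3 : |(n : ℝ) * fwdDiff h τ t| ≤ C + C := by
      have : (n : ℝ) * fwdDiff h τ t = τ (t + n * h) - τ t := by rw [hlin]; ring
      rw [this]
      exact (abs_sub _ _).trans (add_le_add (hC _) (hC _))
    rw [abs_mul, Nat.abs_cast] at h3
    linarith
  have hdown : ∀ j, (fwdDiff h)^[j + 2] σ = 0 → (fwdDiff h)^[2] σ = 0 := by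
    intro j
    induction j with
    | zero => exact id
    | succ j ih => exact fun hj => ih (hstep j hj)
  refine hdown k ?_
  rw [add_comm, Function.iterate_add_apply, hk]
  simp [hz]

/-- The progressions `x, (x+y)/2, y` and `0, (x+y)/2, x+y` share their midpoint, which makes `σ - σ
0` additive; continuity makes it linear. -/
theorem isAffine_of_fwdDiff_two_eq_zero {σ : ℝ → ℝ} (hc : Continuous σ)
    (h0 : ∀ h, (fwdDiff h)^[2] σ = 0) : IsAffine σ := by
  have hmid : ∀ t h, σ (t + h + h) = 2 * σ (t + h) - σ t := by
    intro t h
    have := congrFun (h0 h) t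
    simp only [Function.iterate_succ, Function.iterate_zero, Function.comp, fwdDiff, id,
      Pi.zero_apply] at this
    linarith
  have hadd : ∀ x y, σ (x + y) - σ 0 = (σ x - σ 0) + (σ y - σ 0) := by
    intro x y
    have h1 := hmid x ((y - x) / 2)
    have h2 := hmid 0 ((x + y) / 2)
    have e1 : x + (y - x) / 2 = (x + y) / 2 := by ring
    have e2 : (x + y) / 2 + (y - x) / 2 = y := by ring
    have e3 : (0 : ℝ) + (x + y) / 2 = (x + y) / 2 := by ring
    have e4 : (x + y) / 2 + (x + y) / 2 = x + y := by ring
    rw [e1, e2] at h1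
    rw [e3, e4] at h2
    linarith
  let φ : ℝ →+ ℝ := AddMonoidHom.mk' (fun x => σ x - σ 0) hadd
  have hφ : Continuous φ := hc.sub continuous_const
  refine ⟨φ 1, σ 0, fun x => ?_⟩
  have := map_real_smul φ hφ x 1
  simp only [smul_eq_mul, mul_one] at this
  have h2 : φ x = σ x - σ 0 := rfl
  linarith

/-- A Lipschitz non-affine activation generates, uniformly on bounded sets, all continuous
functions. -/
theorem continuous_mem_localClosure {σ : ℝ → ℝ} (hσL : ∃ L, LipschitzWith L σ)
    (hσ : ¬ IsAffine σ) {f : ℝ → ℝ} (hf : Continuous f) : f ∈ localClosure (ridgeSpan σ) := by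
  have hc : Continuous σ := hσL.choose_spec.continuous
  have hpow : ∀ k : ℕ, (fun t : ℝ => t ^ k) ∈ localClosure (ridgeSpan σ) := by
    intro k
    induction k using Nat.strong_induction_on with
    | _ k ih =>
      -- This difference is the `k`-th derivative at `b` of the `k`-fold moving integral of `σ`.
      obtain ⟨h, b, hb⟩ : ∃ h b, (fwdDiff h)^[k] σ b ≠ 0 := by
        by_contra! hcon
        refine hσ (isAffine_of_fwdDiff_two_eq_zero hc fun h => ?_)
        exact fwdDiff_two_eq_zero hσL.choose_spec h k (funext (hcon h))
      obtain ⟨h1, h2⟩ := iterate_movingIntegral h hc k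
      refine pow_mem_of_iteratedDeriv_ne_zero (iterate_movingIntegral_mem hσL h k).2 h1 (b := b)
        ?_ ih
      rwa [h2]
  refine localClosure_localClosure_le _ fun R ε hε => ?_
  obtain ⟨p, hp⟩ := exists_polynomial_near_of_continuousOn (-R) R f hf.continuousOn ε hε
  refine ⟨fun t => p.eval t, ?_, fun t ht => ?_⟩
  · have : (fun t => p.eval t) = ∑ i ∈ Finset.range (p.natDegree + 1),
        p.coeff i • fun t : ℝ => t ^ i := by
      funext t
      simp [Polynomial.eval_eq_sum_range]
    rw [this]
    exact Submodule.sum_mem _ fun i _ => Submodule.smul_mem _ _ (hpow i)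
  · rw [abs_sub_comm]
    exact (hp t (abs_le.1 ht)).le

/-! ### Composition and uniform limits of attainable maps -/

section Attainable

variable {E : Type*} [NormedAddCommGroup E] [NormedSpace ℝ E] {𝓕 : Set (E → E)}

theorem IsFlow.nonneg {t : ℝ} {φ : E → E} (h : IsFlow 𝓕 t φ) : 0 ≤ t := by
  induction h with
  | single _ ht _ => exact ht
  | comp _ _ ht _ ih => exact add_nonneg ih ht

theorem IsFlow.trans {s t : ℝ} {φ ψ : E → E} (hψ : IsFlow 𝓕 s ψ) (hφ : IsFlow 𝓕 t φ) :
    IsFlow 𝓕 (s + t) (φ ∘ ψ) := by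
  induction hφ with
  | single hf ht hm => exact .comp hψ hf ht hm
  | comp _ hf ht hm ih =>
    have := IsFlow.comp ih hf ht hm
    rwa [add_assoc] at this

theorem mem_attainableSet {φ : E → E} : φ ∈ attainableSet 𝓕 ↔ ∃ t, IsFlow 𝓕 t φ := by
  simp only [attainableSet, attainableSetWithin, Set.mem_iUnion, Set.mem_ofPred_eq]
  constructor
  · rintro ⟨_, _, t, _, h⟩
    exact ⟨t, h⟩
  · rintro ⟨t, h⟩
    exact ⟨t, h.nonneg, t, ⟨h.nonneg, le_rfl⟩, h⟩

theorem comp_mem_attainableSet {φ ψ : E → E} (hφ : φ ∈ attainableSet 𝓕)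
    (hψ : ψ ∈ attainableSet 𝓕) : φ ∘ ψ ∈ attainableSet 𝓕 := by
  rw [mem_attainableSet] at *
  obtain ⟨t, ht⟩ := hφ
  obtain ⟨s, hs⟩ := hψ
  exact ⟨_, hs.trans ht⟩

theorem mem_attainableSet_of_isFlowMap {f φ : E → E} {t : ℝ} (hf : f ∈ 𝓕) (ht : 0 ≤ t)
    (h : IsFlowMap f t φ) : φ ∈ attainableSet 𝓕 :=
  mem_attainableSet.2 ⟨t, .single hf ht h⟩

/-- The continuous maps that are limits, uniformly on compact sets, of attainable maps. -/
def approxAttainable (𝓕 : Set (E → E)) : Set (E → E) :=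
  {Φ | Continuous Φ ∧ ∀ K : Set E, IsCompact K → ∀ ε : ℝ, 0 < ε →
    ∃ φ ∈ attainableSet 𝓕, ∀ x ∈ K, dist (φ x) (Φ x) < ε}

theorem comp_mem_approxAttainable [ProperSpace E] {Φ Ψ : E → E} (hΦ : Φ ∈ approxAttainable 𝓕)
    (hΨ : Ψ ∈ approxAttainable 𝓕) : Φ ∘ Ψ ∈ approxAttainable 𝓕 := by
  refine ⟨hΦ.1.comp hΨ.1, fun K hK ε hε => ?_⟩
  -- The unit margin keeps the approximants of `Ψ` on `K` inside a compact set fixed in advance, on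
  -- which `Φ` is uniformly continuous.
  set K' := Metric.cthickening 1 (Ψ '' K)
  have hK' : IsCompact K' := (hK.image hΨ.1).cthickening
  obtain ⟨φ, hφ, h⟩ := hΦ.2 K' hK' (ε / 2) (half_pos hε)
  obtain ⟨δ, hδ, hu⟩ := Metric.uniformContinuousOn_iff.1
    (hK'.uniformContinuousOn_of_continuous hΦ.1.continuousOn) (ε / 2) (half_pos hε)
  obtain ⟨ψ, hψ, h'⟩ := hΨ.2 K hK (min δ 1) (lt_min hδ one_pos)
  refine ⟨φ ∘ ψ, comp_mem_attainableSet hφ hψ, fun x hx => ?_⟩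
  have h1 := h' x hx
  have h2 : ψ x ∈ K' := Metric.mem_cthickening_of_dist_le _ _ _ _ (Set.mem_image_of_mem Ψ hx)
    (h1.le.trans (min_le_right _ _))
  have h3 : Ψ x ∈ K' := Metric.self_subset_cthickening _ (Set.mem_image_of_mem Ψ hx)
  have h4 := hu _ h2 _ h3 (h1.trans_le (min_le_left _ _))
  have h5 := dist_triangle (φ (ψ x)) (Φ (ψ x)) (Φ (Ψ x))
  simp only [Function.comp_apply]
  linarith [h _ h2]

end Attainable

/-! ### Shears -/

section Fields

variable {d : ℕ} {σ : ℝ → ℝ}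

theorem single_eq_smul (i : Fin d) (c : ℝ) :
    EuclideanSpace.single i c = c • EuclideanSpace.single i (1 : ℝ) := by
  ext l
  by_cases h : l = i <;> simp [h]

theorem continuous_single (i : Fin d) :
    Continuous fun c : ℝ => (EuclideanSpace.single i c : EuclideanSpace ℝ (Fin d)) := by
  rw [show (fun c : ℝ => (EuclideanSpace.single i c : EuclideanSpace ℝ (Fin d))) = _ from
    funext (single_eq_smul i)]
  fun_prop

theorem norm_single_eq_abs (i : Fin d) (c : ℝ) :
    ‖(EuclideanSpace.single i c : EuclideanSpace ℝ (Fin d))‖ = |c| := by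
  simp

/-- Rank-one weights: `W = e_i cᵀ` and `A = a e_jᵀ`. The case `i = j` is allowed and serves for the
contraction. -/
theorem single_mem_controlFamily (σ : ℝ → ℝ) (i j : Fin d) (c a b : Fin d → ℝ) :
    (fun x : EuclideanSpace ℝ (Fin d) =>
      EuclideanSpace.single i (∑ k, c k * σ (a k * x j + b k))) ∈ controlFamily d σ := by
  refine ⟨Matrix.vecMulVec (Pi.single i 1) c, Matrix.vecMulVec a (Pi.single j 1),
    WithLp.toLp 2 b, ?_⟩
  funext x
  ext l
  simp only [field, Matrix.vecMulVec_mulVec]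
  by_cases h : l = i
  · subst h
    simp [dotProduct, Pi.single_apply]
  · simp [h]

theorem isFlowMap_single {v : EuclideanSpace ℝ (Fin d) → ℝ} {i : Fin d} {t : ℝ}
    (u : EuclideanSpace ℝ (Fin d) → ℝ → ℝ) (h0 : ∀ x, u x 0 = 0)
    (hd : ∀ x, ∀ s ∈ Set.Icc 0 t,
      HasDerivWithinAt (u x) (v (x + EuclideanSpace.single i (u x s))) (Set.Icc 0 t) s) :
    IsFlowMap (fun x => EuclideanSpace.single i (v x)) t
      (fun x => x + EuclideanSpace.single i (u x t)) := by
  have hs := single_eq_smul i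
  intro x
  refine ⟨fun s => x + EuclideanSpace.single i (u x s), ?_, fun s hs' => ?_, rfl⟩
  · simp [h0]
  · simp only [hs (u x _), hs (v _)]
    have := ((hd x s hs').smul_const (EuclideanSpace.single i (1 : ℝ))).const_add x
    rwa [hs (u x s)] at this

/-- Since `x_j` is constant along a field pointing in direction `i`, the time-one flow is a
translation by the field. Shears with the same `i, j` compose by adding their profiles, so the whole
span is reached. -/
theorem shear_mem_attainableSet {i j : Fin d} (hij : i ≠ j) {r : ℝ → ℝ} (hr : r ∈ ridgeSpan σ) :
    (fun x : EuclideanSpace ℝ (Fin d) => x + EuclideanSpace.single i (r (x j))) ∈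
      attainableSet (controlFamily d σ) := by
  have key : ∀ c : ℝ, (fun x : EuclideanSpace ℝ (Fin d) =>
      x + EuclideanSpace.single i (c * r (x j))) ∈ attainableSet (controlFamily d σ) := by
    have hbase : ∀ c a b : ℝ, (fun x : EuclideanSpace ℝ (Fin d) =>
        x + EuclideanSpace.single i (c * σ (a * x j + b))) ∈
          attainableSet (controlFamily d σ) := by
      intro c a b
      have hf := single_mem_controlFamily σ i j (Pi.single j c) (fun _ => a) (fun _ => b)
      have hv : ∀ x : EuclideanSpace ℝ (Fin d),
          ∑ k, (Pi.single j c : Fin d → ℝ) k * σ (a * x j + b) = c * σ (a * x j + b) := by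
        intro x
        rw [Finset.sum_eq_single j] <;> simp +contextual
      simp only [hv] at hf
      have := isFlowMap_single (v := fun x : EuclideanSpace ℝ (Fin d) => c * σ (a * x j + b))
        (i := i) (t := 1) (fun x s => s * (c * σ (a * x j + b))) (fun x => zero_mul _) ?_
      · simpa using mem_attainableSet_of_isFlowMap hf zero_le_one this
      · intro x s _
        have hj : (x + EuclideanSpace.single i (s * (c * σ (a * x j + b)))) j = x j := by
          simp [hij.symm]
        simp only [hj]
        simpa using ((hasDerivAt_id s).mul_const (c * σ (a * x j + b))).hasDerivWithinAt
    induction hr using Submodule.span_induction with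
    | mem g h =>
      obtain ⟨p, rfl⟩ := h
      exact fun c => hbase c p.1 p.2
    | zero => simpa using fun _ : ℝ => hbase 0 0 0
    | add f g _ _ hf hg =>
      intro c
      convert comp_mem_attainableSet (hf c) (hg c) using 1
      funext x
      ext l
      by_cases h : l = i
      · subst h
        simp [hij.symm]
        ring
      · simp [h]
    | smul b f _ hf =>
      intro c
      simpa [mul_assoc] using hf (c * b)
  simpa using key 1

theorem shear_mem_approxAttainable (hσL : ∃ L, LipschitzWith L σ) (hσ : ¬ IsAffine σ)
    {i j : Fin d} (hij : i ≠ j) {h : ℝ → ℝ} (hh : Continuous h) :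
    (fun x : EuclideanSpace ℝ (Fin d) => x + EuclideanSpace.single i (h (x j))) ∈
      approxAttainable (controlFamily d σ) := by
  have hcont := continuous_single i
  refine ⟨continuous_id.add (hcont.comp (hh.comp (by fun_prop))), fun K hK ε hε => ?_⟩
  obtain ⟨R, hR⟩ := hK.isBounded.exists_norm_le
  obtain ⟨r, hr, hrh⟩ := continuous_mem_localClosure hσL hσ hh R (ε / 2) (half_pos hε)
  refine ⟨_, shear_mem_attainableSet hij hr, fun x hx => ?_⟩
  rw [dist_add_left, dist_comm, single_eq_smul, single_eq_smul i (r _), dist_eq_norm, ← sub_smul,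
    ← single_eq_smul, norm_single_eq_abs]
  exact (hrh _ ((PiLp.norm_apply_le x j).trans (hR x hx))).trans_lt (half_lt_self hε)

end Fields

/-! ### Collapsing a coordinate by a contracting flow -/

section Contraction

/-- A Lipschitz function is differentiable almost everywhere and absolutely continuous; were all its
derivatives zero, it would be constant, hence affine. -/
theorem exists_hasDerivAt_ne_zero {σ : ℝ → ℝ} (hσL : ∃ L, LipschitzWith L σ)
    (hσ : ¬ IsAffine σ) : ∃ z D, D ≠ 0 ∧ HasDerivAt σ D z := by
  obtain ⟨L, hL⟩ := hσL
  by_contra! hcon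
  have hae : ∀ᵐ x, HasDerivAt σ 0 x := by
    filter_upwards [hL.ae_differentiableAt_real] with x hx
    by_cases h : deriv σ x = 0
    · exact h ▸ hx.hasDerivAt
    · exact absurd hx.hasDerivAt (hcon x _ h)
  refine hσ ⟨0, σ 0, fun x => ?_⟩
  obtain ⟨C, hC⟩ := ((hL.lipschitzOnWith (s := Set.uIcc 0 x)).absolutelyContinuousOnInterval
    ).const_of_ae_hasDerivAt_zero (hae.mono fun y hy _ => hy)
  rw [hC x Set.right_mem_uIcc, hC 0 Set.left_mem_uIcc]
  ring

theorem exists_solution_of_lipschitzWith {G : ℝ → ℝ} {K : NNReal} (hG : LipschitzWith K G)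
    {τ : ℝ} (hτ : 0 ≤ τ) (hK : K * τ ≤ 1 / 2) (y₀ : ℝ) :
    ∃ u : ℝ → ℝ, u 0 = y₀ ∧
      ∀ s ∈ Set.Icc 0 τ, HasDerivWithinAt u (G (u s)) (Set.Icc 0 τ) s := by
  -- On the ball of this radius the speed is at most `|G y₀| + K a`, so in time `τ` a solution moves
  -- at most `|G y₀| τ + a / 2 = a`. The time `τ` is the same for all initial values.
  set a : NNReal := ⟨2 * |G y₀| * τ, by positivity⟩ with ha
  have hpl : IsPicardLindelof (fun _ => G) (tmin := 0) (tmax := τ) ⟨0, le_rfl, hτ⟩ y₀ a 0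
      (‖G y₀‖₊ + K * a) K := by
    refine .of_time_independent (fun x hx => ?_) hG.lipschitzOnWith ?_
    · have h1 := hG.dist_le_mul x y₀
      rw [Metric.mem_closedBall] at hx
      rw [dist_eq_norm] at h1
      have h2 := norm_le_norm_sub_add (G x) (G y₀)
      push_cast
      have h3 : (K : ℝ) * dist x y₀ ≤ K * a := by gcongr
      linarith
    · have ha' : (a : ℝ) = 2 * |G y₀| * τ := rfl
      simp only [sub_zero, sub_self, NNReal.coe_zero]
      rw [max_eq_left hτ]
      push_cast
      rw [Real.norm_eq_abs, ha']
      nlinarith [mul_nonneg (abs_nonneg (G y₀)) hτ]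
  exact hpl.exists_eq_forall_mem_Icc_hasDerivWithinAt₀

/-- Comparison of `u²` with `r² exp (-μ s)`: where they meet, `u²` decays at rate at least `2μ`.
Claiming only the rate `μ` gives the strict inequality that the comparison principle needs. -/
theorem abs_le_of_contracting {G u : ℝ → ℝ} {τ μ R r : ℝ} (hτ : 0 ≤ τ) (hμ : 0 < μ)
    (hG : ∀ y, |y| ≤ R → y * G y ≤ -μ * y ^ 2) (hr : 0 < r) (hrR : r ≤ R)
    (hu : ∀ s ∈ Set.Icc 0 τ, HasDerivWithinAt u (G (u s)) (Set.Icc 0 τ) s) (h0 : |u 0| ≤ r) :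
    |u τ| ≤ r * Real.exp (-(μ / 2) * τ) := by
  have hB : ∀ s, HasDerivAt (fun s => r ^ 2 * Real.exp (-μ * s))
      (r ^ 2 * (Real.exp (-μ * s) * -μ)) s := fun s => by
    have h1 : HasDerivAt (fun s => -μ * s) (-μ) s := by
      simpa using (hasDerivAt_id s).const_mul (-μ)
    exact h1.exp.const_mul _
  have hw : ∀ s ∈ Set.Icc 0 τ,
      HasDerivWithinAt (fun s => u s ^ 2) (2 * (u s * G (u s))) (Set.Icc 0 τ) s := fun s hs => by
    exact ((hu s hs).fun_pow 2).congr_deriv (by push_cast; ring)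
  have hfin := image_le_of_deriv_right_lt_deriv_boundary' (f := fun s => u s ^ 2)
    (f' := fun s => 2 * (u s * G (u s))) (a := 0) (b := τ)
    (fun s hs => (hw s hs).continuousWithinAt)
    (fun s hs => (hw s ⟨hs.1, hs.2.le⟩).mono_of_mem_nhdsWithin (Icc_mem_nhdsGE_of_mem hs))
    (B := fun s => r ^ 2 * Real.exp (-μ * s))
    (B' := fun s => r ^ 2 * (Real.exp (-μ * s) * -μ)) ?_
    (fun s _ => (hB s).continuousAt.continuousWithinAt) (fun s _ => (hB s).hasDerivWithinAt) ?_
    (Set.right_mem_Icc.2 hτ)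
  · refine abs_le_of_sq_le_sq (hfin.trans (le_of_eq ?_)) (by positivity)
    rw [mul_pow, ← Real.exp_nat_mul]
    congr 2
    push_cast
    ring
  · simpa using sq_le_sq' (by linarith [(abs_le.1 h0).1]) (abs_le.1 h0).2
  · intro s hs hEq
    have hpos : 0 < r ^ 2 * Real.exp (-μ * s) := by positivity
    have hexp : Real.exp (-μ * s) ≤ 1 := Real.exp_le_one_iff.2 (by nlinarith [hs.1])
    have hle : u s ^ 2 ≤ R ^ 2 := by
      rw [hEq]
      nlinarith [sq_nonneg r]
    have := hG (u s) (abs_le_of_sq_le_sq hle (hr.le.trans hrR))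
    rw [hEq] at this
    nlinarith [mul_pos hμ hpos]

/-- The map sending the coordinate `i` to `0` is a limit of attainable maps. -/
theorem proj_mem_approxAttainable {d : ℕ} {σ : ℝ → ℝ} (hσL : ∃ L, LipschitzWith L σ)
    (hσ : ¬ IsAffine σ) {i j : Fin d} (hij : i ≠ j) :
    (fun x : EuclideanSpace ℝ (Fin d) => x - EuclideanSpace.single i (x i)) ∈
      approxAttainable (controlFamily d σ) := by
  have hcont := continuous_single i
  refine ⟨continuous_id.sub (hcont.comp (by fun_prop)), fun K hK ε hε => ?_⟩
  obtain ⟨R, hR0, hR⟩ := hK.isBounded.exists_pos_norm_le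
  obtain ⟨z, D, hD, hz⟩ := exists_hasDerivAt_ne_zero hσL hσ
  obtain ⟨L, hL⟩ := hσL
  obtain ⟨ρ, hρ, hloc⟩ := Metric.eventually_nhds_iff.1
    (hz.isLittleO.def (c := |D| / 2) (by positivity))
  set a := ρ / (2 * R) with ha
  have ha0 : 0 < a := by positivity
  -- To first order `G y = -D² y`. The scale `a` keeps `a y + z` within `ρ` of `z` for `|y| ≤ R`,
  -- where the linearisation error costs at most half of the rate.
  set G : ℝ → ℝ := fun y => -(D / a) * (σ (a * y + z) - σ z) with hGdef
  set M : NNReal := ‖D‖₊ * L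
  have hGL : LipschitzWith M G := by
    refine LipschitzWith.of_dist_le_mul fun x y => ?_
    have h1 := hL.dist_le_mul (a * x + z) (a * y + z)
    rw [Real.dist_eq, Real.dist_eq, add_sub_add_right_eq_sub, ← mul_sub, abs_mul,
      abs_of_pos ha0] at h1
    have h2 : G x - G y = -(D / a) * (σ (a * x + z) - σ (a * y + z)) := by
      simp only [hGdef]; ring
    rw [Real.dist_eq, Real.dist_eq, h2, abs_mul, abs_neg, abs_div, abs_of_pos ha0]
    calc |D| / a * |σ (a * x + z) - σ (a * y + z)| ≤ |D| / a * (L * (a * |x - y|)) := by gcongr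
      _ = |D| * L * |x - y| := by field_simp
      _ = M * |x - y| := by simp [M]
  have hGc : ∀ y, |y| ≤ R → y * G y ≤ -(D ^ 2 / 2) * y ^ 2 := by
    intro y hy
    have h1 : dist (a * y + z) z < ρ := by
      rw [Real.dist_eq, add_sub_cancel_right, abs_mul, abs_of_pos ha0]
      calc a * |y| ≤ a * R := by gcongr
        _ = ρ / 2 := by rw [ha]; field_simp
        _ < ρ := by linarith
    have h2 := hloc h1
    simp only [add_sub_cancel_right, Real.norm_eq_abs, smul_eq_mul] at h2
    set S := σ (a * y + z) - σ z
    have h3 : |D * (a * y) * (S - a * y * D)| ≤ D ^ 2 / 2 * (a * y) ^ 2 := by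
      rw [abs_mul, abs_mul]
      calc |D| * |a * y| * |S - a * y * D| ≤ |D| * |a * y| * (|D| / 2 * |a * y|) := by gcongr
        _ = |D| ^ 2 / 2 * |a * y| ^ 2 := by ring
        _ = _ := by rw [sq_abs, sq_abs]
    have h4 := (abs_le.1 h3).1
    have h5 : D ^ 2 / 2 * (a * y) ^ 2 ≤ D * (a * y) * S := by nlinarith
    have h6 : y * G y = -(D * (a * y) * S) / a ^ 2 := by
      simp only [hGdef, S]
      field_simp
    rw [h6, div_le_iff₀ (by positivity)]
    linarith
  set τ : ℝ := 1 / (2 * (M + 1)) with hτdef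
  have hτ : 0 < τ := by positivity
  have hMτ : M * τ ≤ 1 / 2 := by
    rw [hτdef, mul_one_div, div_le_div_iff₀ (by positivity) two_pos]
    linarith
  choose u hu0 hu using exists_solution_of_lipschitzWith hGL hτ.le hMτ
  set q := Real.exp (-(D ^ 2 / 2 / 2) * τ) with hq
  have hq1 : q < 1 := by
    rw [hq, Real.exp_lt_one_iff]
    have : 0 < D ^ 2 := by positivity
    nlinarith
  set P : ℝ → ℝ := fun y => u y τ
  have hP : ∀ r, 0 < r → r ≤ R → ∀ y, |y| ≤ r → |P y| ≤ r * q := fun r hr hrR y hy =>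
    abs_le_of_contracting hτ.le (by positivity) hGc hr hrR (hu y) (by rwa [hu0])
  set φ : EuclideanSpace ℝ (Fin d) → EuclideanSpace ℝ (Fin d) :=
    fun x => x + EuclideanSpace.single i (P (x i) - x i) with hφdef
  have hφ : φ ∈ attainableSet (controlFamily d σ) := by
    -- Neuron `i` computes `σ (a x_i + z)`; neuron `j`, with zero input weight, supplies the
    -- constant `σ z`. Here a second coordinate is needed.
    have hf := single_mem_controlFamily σ i i
      (fun k => if k = i then -(D / a) else if k = j then D / a else 0)
      (fun k => if k = i then a else 0) (fun _ => z)
    have hv : ∀ x : EuclideanSpace ℝ (Fin d),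
        ∑ k, (if k = i then -(D / a) else if k = j then D / a else 0) *
          σ ((if k = i then a else 0) * x i + z) = G (x i) := by
      intro x
      rw [Finset.sum_eq_add i j hij]
      · simp only [hGdef, if_true, if_neg hij.symm]
        rw [zero_mul, zero_add]
        ring
      · intro k _ hk
        simp [hk.1, hk.2]
      · simp
      · simp
    simp only [hv] at hf
    refine mem_attainableSet_of_isFlowMap hf hτ.le
      (isFlowMap_single (v := fun x => G (x i)) (fun x s => u (x i) s - x i)
        (fun x => by simp [hu0]) fun x s hs => ?_)
    have := (hu (x i) s hs).sub_const (x i)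
    simpa using this
  have hiter : ∀ n : ℕ, ∃ ψ ∈ attainableSet (controlFamily d σ),
      ∀ x, ∃ y, ψ x = x + EuclideanSpace.single i (y - x i) ∧ (|x i| ≤ R → |y| ≤ R * q ^ (n + 1)) := by
    intro n
    induction n with
    | zero =>
      refine ⟨φ, hφ, fun x => ⟨P (x i), rfl, fun hx => ?_⟩⟩
      simpa using hP R hR0 le_rfl _ hx
    | succ n ih =>
      obtain ⟨ψ, hψ, h⟩ := ih
      refine ⟨φ ∘ ψ, comp_mem_attainableSet hφ hψ, fun x => ?_⟩
      obtain ⟨y, hy, hyR⟩ := h x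
      have hyi : ψ x i = y := by rw [hy]; simp
      refine ⟨P y, ?_, fun hx => ?_⟩
      · rw [Function.comp_apply, hφdef]
        simp only
        rw [hyi, hy, add_assoc, single_eq_smul, single_eq_smul i (P y - y),
          single_eq_smul i (P y - x i), ← add_smul]
        congr 2
        ring
      · have := hP (R * q ^ (n + 1)) (by positivity)
          (mul_le_of_le_one_right hR0.le (pow_le_one₀ (by positivity) hq1.le)) y (hyR hx)
        rwa [mul_assoc, ← pow_succ] at this
  obtain ⟨n, hn⟩ := exists_pow_lt_of_lt_one (div_pos hε hR0) hq1
  obtain ⟨ψ, hψ, h⟩ := hiter n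
  refine ⟨ψ, hψ, fun x hx => ?_⟩
  obtain ⟨y, hy, hyR⟩ := h x
  have h1 : ψ x - (x - EuclideanSpace.single i (x i)) = EuclideanSpace.single i y := by
    rw [hy, single_eq_smul, single_eq_smul i (x i), single_eq_smul i y, sub_smul]
    abel
  rw [dist_eq_norm, h1, norm_single_eq_abs]
  calc |y| ≤ R * q ^ (n + 1) := hyR ((PiLp.norm_apply_le x i).trans (hR x hx))
    _ ≤ R * q ^ n := by
      refine mul_le_mul_of_nonneg_left ?_ hR0.le
      exact pow_le_pow_of_le_one (by positivity) hq1.le (Nat.le_succ n)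
    _ < R * (ε / R) := by gcongr
    _ = ε := by field_simp

end Contraction

/-! ### Overwriting coordinates by functions of other coordinates -/

section Overwriting

variable {d : ℕ} {σ : ℝ → ℝ}

/-- The coordinate is first collapsed to zero, then a shear writes the new value into it. -/
theorem overwrite_mem_approxAttainable (hσL : ∃ L, LipschitzWith L σ) (hσ : ¬ IsAffine σ)
    {i j : Fin d} (hij : i ≠ j) {g : ℝ → ℝ} (hg : Continuous g) :
    (fun x : EuclideanSpace ℝ (Fin d) => x + EuclideanSpace.single i (g (x j) - x i)) ∈
      approxAttainable (controlFamily d σ) := by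
  convert comp_mem_approxAttainable (shear_mem_approxAttainable hσL hσ hij hg)
    (proj_mem_approxAttainable hσL hσ hij) using 1
  funext x
  ext l
  by_cases h : l = i
  · subst h
    simp [hij.symm]
  · simp [h, hij.symm]

theorem single_eq_zero (i : Fin d) : EuclideanSpace.single i (0 : ℝ) = 0 := by
  rw [single_eq_smul, zero_smul]

theorem id_mem_approxAttainable (hσL : ∃ L, LipschitzWith L σ) (hσ : ¬ IsAffine σ)
    {i j : Fin d} (hij : i ≠ j) :
    (fun x : EuclideanSpace ℝ (Fin d) => x) ∈ approxAttainable (controlFamily d σ) := by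
  simpa [single_eq_zero] using
    shear_mem_approxAttainable hσL hσ hij (h := fun _ => 0) continuous_const

theorem sum_shear_mem_approxAttainable (hσL : ∃ L, LipschitzWith L σ) (hσ : ¬ IsAffine σ)
    {i j : Fin d} (hij : i ≠ j) {f : Fin d → ℝ → ℝ} (hf : ∀ k, Continuous (f k))
    (s : Finset (Fin d)) (hs : i ∉ s) :
    (fun x : EuclideanSpace ℝ (Fin d) => x + EuclideanSpace.single i (∑ k ∈ s, f k (x k))) ∈
      approxAttainable (controlFamily d σ) := by
  induction s using Finset.induction_on with
  | empty => simpa [single_eq_zero] using id_mem_approxAttainable hσL hσ hij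
  | insert k s hk ih =>
    have hik : i ≠ k := fun h => hs (h ▸ Finset.mem_insert_self _ _)
    convert comp_mem_approxAttainable (shear_mem_approxAttainable hσL hσ hik (hf k))
      (ih fun h => hs (Finset.mem_insert_of_mem h)) using 1
    funext x
    ext l
    by_cases h : l = i
    · subst h
      simp [hik.symm, Finset.sum_insert hk]
      ring
    · simp [h]

theorem overwrite_all_mem_approxAttainable (hσL : ∃ L, LipschitzWith L σ) (hσ : ¬ IsAffine σ)
    {i j : Fin d} (hij : i ≠ j) {g : Fin d → ℝ → ℝ} (hg : ∀ k, Continuous (g k))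
    (s : Finset (Fin d)) (hs : i ∉ s) :
    (fun x : EuclideanSpace ℝ (Fin d) =>
      WithLp.toLp 2 fun k => if k ∈ s then g k (x i) else x k) ∈
      approxAttainable (controlFamily d σ) := by
  induction s using Finset.induction_on with
  | empty => simpa using id_mem_approxAttainable hσL hσ hij
  | insert k s hk ih =>
    have hik : i ≠ k := fun h => hs (h ▸ Finset.mem_insert_self _ _)
    have his : i ∉ s := fun h => hs (Finset.mem_insert_of_mem h)
    convert comp_mem_approxAttainable (overwrite_mem_approxAttainable hσL hσ hik.symm (hg k))
      (ih his) using 1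
    funext x
    ext l
    by_cases h : l = k
    · subst h
      simp [his]
    · simp [h]

/-- The curve in `ℝ^d` with coordinates `q k`, except that the coordinate `i` is computed from the
coordinate `j` by `h`. -/
def curve (i j : Fin d) (q : Fin d → ℝ → ℝ) (h : ℝ → ℝ) (t : ℝ) : EuclideanSpace ℝ (Fin d) :=
  WithLp.toLp 2 fun k => if k = i then h (q j t) else q k t

theorem continuous_curve (i j : Fin d) {q : Fin d → ℝ → ℝ} (hq : ∀ k, Continuous (q k))
    {h : ℝ → ℝ} (hh : Continuous h) : Continuous (curve i j q h) := by
  refine (PiLp.continuous_toLp 2 _).comp (continuous_pi fun k => ?_)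
  by_cases hk : k = i
  · simpa [hk, Function.comp_def] using hh.comp (hq j)
  · simpa [hk] using hq k

/-- All information is gathered in coordinate `i`, from which the others are overwritten. Coordinate
`i` cannot be overwritten by a function of itself, so its final value is recovered from coordinate
`j`. -/
theorem curve_mem_approxAttainable (hσL : ∃ L, LipschitzWith L σ) (hσ : ¬ IsAffine σ)
    {i j : Fin d} (hij : i ≠ j) {f q : Fin d → ℝ → ℝ} (hf : ∀ k, Continuous (f k))
    (hq : ∀ k, Continuous (q k)) {h : ℝ → ℝ} (hh : Continuous h) :
    (fun x : EuclideanSpace ℝ (Fin d) =>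
      curve i j q h (x i + ∑ k ∈ Finset.univ.erase i, f k (x k))) ∈
      approxAttainable (controlFamily d σ) := by
  convert comp_mem_approxAttainable (overwrite_mem_approxAttainable hσL hσ hij hh)
    (comp_mem_approxAttainable
      (overwrite_all_mem_approxAttainable hσL hσ hij hq _ (Finset.notMem_erase i Finset.univ))
      (sum_shear_mem_approxAttainable hσL hσ hij hf _ (Finset.notMem_erase i Finset.univ))) using 1
  funext x
  ext l
  by_cases hl : l = i
  · subst hl
    simp [curve, hij.symm]
  · simp [curve, hl]

end Overwriting

/-! ### Interpolating curves and staircases -/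

section Interpolation

theorem exists_continuous_interpolation {M : ℕ} {u : Fin M → ℝ} (hu : Function.Injective u)
    (v : Fin M → ℝ) : ∃ h : ℝ → ℝ, Continuous h ∧ ∀ n, h (u n) = v n :=
  ⟨fun t => (Lagrange.interpolate Finset.univ u v).eval t, Polynomial.continuous _, fun n =>
    Lagrange.eval_interpolate_at_node v hu.injOn (Finset.mem_univ n)⟩

theorem exists_injective_near {M : ℕ} (y : Fin M → ℝ) {δ : ℝ} (hδ : 0 < δ) :
    ∃ u : Fin M → ℝ, Function.Injective u ∧ ∀ n, |u n - y n| ≤ δ := by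
  -- Rounding down to the grid `δ ℤ` and adding `δ n / M` makes the values distinct: `n` is the
  -- residue modulo `M` after scaling.
  refine ⟨fun n => δ * (⌊y n / δ⌋ + (n : ℕ) / M), fun n n' h => ?_, fun n => ?_⟩
  · have hM : (0 : ℝ) < M := by exact_mod_cast n.pos
    have h1 := mul_left_cancel₀ hδ.ne' h
    field_simp at h1
    have h2 : (M : ℤ) * ⌊y n / δ⌋ + (n : ℕ) = M * ⌊y n' / δ⌋ + (n' : ℕ) := by
      have : (M : ℝ) * ⌊y n / δ⌋ + (n : ℕ) = M * ⌊y n' / δ⌋ + (n' : ℕ) := by linarith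
      exact_mod_cast this
    have h3 := congrArg (· % (M : ℤ)) h2
    simp only [Int.mul_add_emod_self_left] at h3
    rw [Int.emod_eq_of_lt (by positivity) (by exact_mod_cast n.2),
      Int.emod_eq_of_lt (by positivity) (by exact_mod_cast n'.2)] at h3
    exact Fin.ext (by exact_mod_cast h3)
  · have hM : (0 : ℝ) < M := by exact_mod_cast n.pos
    have hn : ((n : ℕ) : ℝ) / M ≤ 1 := by
      rw [div_le_one hM]
      exact_mod_cast n.2.le
    have hn0 : 0 ≤ ((n : ℕ) : ℝ) / M := by positivity
    have h1 : y n = δ * (y n / δ) := by field_simp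
    have h2 : δ * (⌊y n / δ⌋ + (n : ℕ) / M) - y n =
        δ * ((⌊y n / δ⌋ - y n / δ) + (n : ℕ) / M) := by
      linear_combination -h1
    rw [h2, abs_mul, abs_of_pos hδ]
    refine mul_le_of_le_one_right hδ.le (abs_le.2 ⟨?_, ?_⟩)
    · linarith [Int.lt_floor_add_one (y n / δ)]
    · linarith [Int.floor_le (y n / δ)]

/-- Coordinate `i` of the curve is a function of coordinate `j`, so the `j`-th coordinates of the
nodes must be distinct. Perturbing only them achieves this. -/
theorem exists_curve_near {d M : ℕ} {i j : Fin d} (hij : i ≠ j)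
    (y : Fin M → EuclideanSpace ℝ (Fin d)) {δ : ℝ} (hδ : 0 < δ) :
    ∃ (q : Fin d → ℝ → ℝ) (h : ℝ → ℝ), (∀ k, Continuous (q k)) ∧ Continuous h ∧
      ∀ n : Fin M, dist (curve i j q h (n : ℕ)) (y n) ≤ δ := by
  obtain ⟨u, hu, huy⟩ := exists_injective_near (fun n => y n j) hδ
  have hinj : Function.Injective fun n : Fin M => ((n : ℕ) : ℝ) :=
    Nat.cast_injective.comp Fin.val_injective
  choose q hq hqv using fun k => exists_continuous_interpolation hinj
    (fun n => if k = j then u n else y n k)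
  obtain ⟨h, hh, hv⟩ := exists_continuous_interpolation hu fun n => y n i
  refine ⟨q, h, hq, hh, fun n => ?_⟩
  have : curve i j q h (n : ℕ) - y n = EuclideanSpace.single j (u n - y n j) := by
    ext k
    by_cases hk : k = i
    · subst hk
      simp [curve, hqv, hv, hij]
    · by_cases hkj : k = j
      · subst hkj
        simp [curve, hqv, hk]
      · simp [curve, hqv, hk, hkj]
  rw [dist_eq_norm, this, norm_single_eq_abs]
  exact huy n

/-- A continuous staircase with `M` unit steps, the ramps having slope `n`. -/
noncomputable def staircase (M n : ℕ) (t : ℝ) : ℝ :=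
  ∑ i ∈ Finset.range M, max 0 (min 1 ((t - (i + 1)) * n + 1))

theorem continuous_staircase (M n : ℕ) : Continuous (staircase M n) := by
  unfold staircase
  fun_prop

theorem staircase_mem_Icc (M n : ℕ) (t : ℝ) : staircase M n t ∈ Set.Icc (0 : ℝ) M := by
  refine ⟨Finset.sum_nonneg fun i _ => le_max_left _ _, ?_⟩
  refine (Finset.sum_le_card_nsmul _ _ 1 fun i _ => ?_).trans (by simp)
  exact max_le zero_le_one (min_le_left _ _)

/-- Every ramp ends at its integer rather than starting there, so the limit is the floor at integers
too and no exceptional set arises. -/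
theorem eventually_staircase_eq {M : ℕ} {t : ℝ} (ht : 0 ≤ t) (hM : ⌊t⌋₊ ≤ M) :
    ∀ᶠ n in Filter.atTop, staircase M n t = ⌊t⌋₊ := by
  set m := ⌊t⌋₊ with hm
  have h1 : (m : ℝ) ≤ t := Nat.floor_le ht
  have h2 : t < m + 1 := Nat.lt_floor_add_one t
  obtain ⟨N, hN⟩ := exists_nat_gt (1 / (m + 1 - t))
  filter_upwards [Filter.eventually_ge_atTop N] with n hn
  have hn' : 1 / (m + 1 - t) < n := hN.trans_le (by exact_mod_cast hn)
  rw [div_lt_iff₀ (by linarith)] at hn'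
  have hterm : ∀ i ∈ Finset.range M, max 0 (min 1 ((t - (i + 1)) * n + 1)) =
      if i < m then (1 : ℝ) else 0 := by
    intro i _
    split_ifs with him
    · have h3 : ((i : ℝ) + 1) ≤ m := by exact_mod_cast him
      have h4 : 0 ≤ (t - (i + 1)) * n := mul_nonneg (by linarith) (by positivity)
      rw [min_eq_left (by linarith), max_eq_right zero_le_one]
    · have h3 : (m : ℝ) ≤ i := by exact_mod_cast not_lt.1 him
      refine max_eq_left ((min_le_right _ _).trans ?_)
      have hn0 : (0 : ℝ) ≤ n := by positivity
      nlinarith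
  rw [staircase, Finset.sum_congr rfl hterm, ← Finset.sum_filter, Finset.sum_const, nsmul_one]
  congr 1
  have : (Finset.range M).filter (· < m) = Finset.range m := by
    ext i
    simp only [Finset.mem_filter, Finset.mem_range]
    omega
  rw [this, Finset.card_range]

end Interpolation

/-! ### Digit coding and pointwise approximation -/

theorem sum_mul_pow_lt {d B : ℕ} {a : Fin d → ℕ} (ha : ∀ k, a k < B) :
    ∑ k, a k * B ^ (k : ℕ) < B ^ d := by
  have := (finFunctionFinEquiv fun k => (⟨a k, ha k⟩ : Fin B)).2
  rwa [finFunctionFinEquiv_apply] at this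

theorem eq_of_sum_mul_pow_eq {d B : ℕ} {a b : Fin d → ℕ} (ha : ∀ k, a k < B) (hb : ∀ k, b k < B)
    (h : ∑ k, a k * B ^ (k : ℕ) = ∑ k, b k * B ^ (k : ℕ)) (k : Fin d) : a k = b k := by
  have : (finFunctionFinEquiv fun k => (⟨a k, ha k⟩ : Fin B)) =
      finFunctionFinEquiv fun k => (⟨b k, hb k⟩ : Fin B) := by
    ext
    rwa [finFunctionFinEquiv_apply, finFunctionFinEquiv_apply]
  have h2 := congrFun (finFunctionFinEquiv.injective this) k
  exact congrArg Fin.val h2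

theorem dist_lt_of_forall_abs_sub_le {d : ℕ} {δ : ℝ} (hδ : 0 < δ)
    {x y : EuclideanSpace ℝ (Fin d)} (h : ∀ k, |x k - y k| ≤ δ / (d + 1)) : dist x y < δ := by
  rw [EuclideanSpace.dist_eq, Real.sqrt_lt' hδ]
  have hd : (0 : ℝ) ≤ d := by positivity
  calc ∑ k, dist (x k) (y k) ^ 2 ≤ ∑ _k : Fin d, (δ / (d + 1)) ^ 2 := by
        refine Finset.sum_le_sum fun k _ => ?_
        rw [Real.dist_eq]
        gcongr
        exact h k
    _ = d / (d + 1) ^ 2 * δ ^ 2 := by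
        rw [Finset.sum_const, Finset.card_univ, Fintype.card_fin, nsmul_eq_mul]
        field_simp
    _ < 1 * δ ^ 2 := by
        gcongr
        rw [div_lt_one (by positivity)]
        nlinarith
    _ = δ ^ 2 := one_mul _

theorem exists_bounded_approximation {d m : ℕ} (hd : 2 ≤ d) {σ : ℝ → ℝ}
    (hσL : ∃ L, LipschitzWith L σ) (hσ : ¬ IsAffine σ)
    {g F : EuclideanSpace ℝ (Fin d) → EuclideanSpace ℝ (Fin m)} {L : NNReal}
    (hg : LipschitzWith L g) (hF : Continuous F) {K : Set (EuclideanSpace ℝ (Fin d))}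
    (hK : IsCompact K) (hcover : F '' K ⊆ Set.range g) {ε : ℝ} (hε : 0 < ε) :
    ∃ (Φ : ℕ → EuclideanSpace ℝ (Fin d) → EuclideanSpace ℝ (Fin d)) (C : ℝ),
      (∀ n, Φ n ∈ approxAttainable (controlFamily d σ)) ∧
      (∀ n, ∀ x ∈ K, ‖F x - g (Φ n x)‖ ≤ C) ∧
      ∀ x ∈ K, ∀ᶠ n in Filter.atTop, ‖F x - g (Φ n x)‖ ≤ ε := by
  let i : Fin d := ⟨0, by omega⟩
  let j : Fin d := ⟨1, by omega⟩
  have hij : i ≠ j := by simp [i, j]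
  obtain ⟨δ, hδ, hu⟩ := Metric.uniformContinuousOn_iff.1
    (hK.uniformContinuousOn_of_continuous hF.continuousOn) (ε / 2) (half_pos hε)
  obtain ⟨R, hR0, hR⟩ := hK.isBounded.exists_pos_norm_le
  set w := δ / (d + 1) with hw
  have hw0 : 0 < w := by positivity
  obtain ⟨B, hB⟩ := exists_nat_gt ((R + R) / w)
  set τ : ℝ → ℝ := fun t => (t + R) / w with hτ
  have hτc : Continuous τ := by fun_prop
  set dig : EuclideanSpace ℝ (Fin d) → Fin d → ℕ := fun x k => ⌊τ (x k)⌋₊ with hdig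
  have hτ0 : ∀ x ∈ K, ∀ k, 0 ≤ τ (x k) := fun x hx k => by
    have := (abs_le.1 ((PiLp.norm_apply_le x k).trans (hR x hx))).1
    exact div_nonneg (by linarith) hw0.le
  have hdigB : ∀ x ∈ K, ∀ k, dig x k < B := fun x hx k => by
    rw [hdig, Nat.floor_lt (hτ0 x hx k)]
    refine lt_of_le_of_lt ?_ hB
    have := (abs_le.1 ((PiLp.norm_apply_le x k).trans (hR x hx))).2
    simp only [hτ]
    gcongr
  set code : EuclideanSpace ℝ (Fin d) → ℕ := fun x => ∑ k, dig x k * B ^ (k : ℕ) with hcode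
  set N := B ^ d
  -- Points with equal code have all digits equal, so they differ by at most `w` in each coordinate
  -- and `F` varies little. Empty cells get the irrelevant value `0`.
  have hy : ∀ n : Fin N, ∃ y, ∀ x ∈ K, code x = n → ‖F x - g y‖ ≤ ε / 2 := by
    intro n
    by_cases hn : ∃ x' ∈ K, code x' = n
    · obtain ⟨x', hx', hn⟩ := hn
      obtain ⟨y, hy⟩ := hcover (Set.mem_image_of_mem F hx')
      refine ⟨y, fun x hx hxn => ?_⟩
      have hdd := eq_of_sum_mul_pow_eq (hdigB x hx) (hdigB x' hx') (hxn.trans hn.symm)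
      rw [hy, ← dist_eq_norm]
      refine (hu x hx x' hx' (dist_lt_of_forall_abs_sub_le hδ fun k => ?_)).le
      have h1 : |τ (x k) - τ (x' k)| ≤ 1 := by
        have a1 := Nat.floor_le (hτ0 x hx k)
        have a2 := Nat.lt_floor_add_one (τ (x k))
        have a3 := Nat.floor_le (hτ0 x' hx' k)
        have a4 := Nat.lt_floor_add_one (τ (x' k))
        have a5 : ((⌊τ (x k)⌋₊ : ℕ) : ℝ) = ⌊τ (x' k)⌋₊ := congrArg Nat.cast (hdd k)
        rw [abs_le]
        constructor <;> linarith
      have h2 : τ (x k) - τ (x' k) = (x k - x' k) / w := by simp only [hτ]; ring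
      rw [h2, abs_div, abs_of_pos hw0, div_le_one hw0] at h1
      exact h1
    · exact ⟨0, fun x hx hxn => absurd ⟨x, hx, hxn⟩ hn⟩
  choose y hy using hy
  obtain ⟨q, h, hq, hh, hqy⟩ := exists_curve_near hij y (δ := ε / (2 * (L + 1))) (by positivity)
  refine ⟨fun n x => curve i j (fun k t => q k (staircase N n (τ t))) h
    (x i + ∑ k ∈ Finset.univ.erase i, w * B ^ (k : ℕ) * staircase B n (τ (x k))), ?_⟩
  have hrep : ∀ n t, curve i j (fun k t => q k (staircase N n (τ t))) h t =
      curve i j q h (staircase N n (τ t)) := fun n t => rfl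
  have hcc : Continuous fun t => g (curve i j q h t) :=
    hg.continuous.comp (continuous_curve i j hq hh)
  obtain ⟨C₁, hC₁⟩ :=
    ((isCompact_Icc (a := (0 : ℝ)) (b := (N : ℝ))).image hcc).isBounded.exists_norm_le
  obtain ⟨C₂, hC₂⟩ := (hK.image hF).isBounded.exists_norm_le
  refine ⟨C₂ + C₁, fun n => ?_, fun n x hx => ?_, fun x hx => ?_⟩
  · exact curve_mem_approxAttainable hσL hσ hij
      (f := fun k t => w * B ^ (k : ℕ) * staircase B n (τ t))
      (fun k => continuous_const.mul ((continuous_staircase B n).comp hτc))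
      (fun k => (hq k).comp ((continuous_staircase N n).comp hτc)) hh
  · refine (norm_sub_le _ _).trans (add_le_add (hC₂ _ (Set.mem_image_of_mem F hx)) (hC₁ _ ?_))
    exact ⟨_, staircase_mem_Icc N n _, rfl⟩
  · have hev : ∀ᶠ n in Filter.atTop, ∀ k, staircase B n (τ (x k)) = dig x k :=
      Filter.eventually_all.2 fun k => eventually_staircase_eq (hτ0 x hx k) (hdigB x hx k).le
    -- The coordinate `i` has index `0`, so its digit has weight `1` and needs no prior rounding: `τ
    -- (x i)` plus an integer has the code as its floor, and the second staircase does the rounding.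
    set T : ℝ := τ (x i) + (∑ k ∈ Finset.univ.erase i, dig x k * B ^ (k : ℕ) : ℕ) with hT
    have hT0 : 0 ≤ T := add_nonneg (hτ0 x hx i) (Nat.cast_nonneg _)
    have hTc : ⌊T⌋₊ = code x := by
      rw [hT, Nat.floor_add_natCast (hτ0 x hx i), hcode]
      simp only
      rw [← Finset.add_sum_erase _ _ (Finset.mem_univ i)]
      simp [i, hdig]
    have hlt : code x < N := sum_mul_pow_lt (hdigB x hx)
    filter_upwards [hev, eventually_staircase_eq hT0 (hTc ▸ hlt.le)] with n h1 h2
    have h3 : τ (x i + ∑ k ∈ Finset.univ.erase i, w * B ^ (k : ℕ) * staircase B n (τ (x k))) =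
        T := by
      have : ∑ k ∈ Finset.univ.erase i, w * B ^ (k : ℕ) * staircase B n (τ (x k)) =
          w * (∑ k ∈ Finset.univ.erase i, dig x k * B ^ (k : ℕ) : ℕ) := by
        push_cast
        rw [Finset.mul_sum]
        refine Finset.sum_congr rfl fun k _ => ?_
        rw [h1]
        ring
      rw [this, hT]
      simp only [hτ]
      field_simp
      ring
    rw [hrep, h3, h2, hTc]
    have h4 := hqy ⟨code x, hlt⟩
    have h5 := hy ⟨code x, hlt⟩ x hx rfl
    have h6 := hg.dist_le_mul (curve i j q h (code x : ℕ)) (y ⟨code x, hlt⟩)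
    have h7 : (L : ℝ) * dist (curve i j q h (code x : ℕ)) (y ⟨code x, hlt⟩) ≤ ε / 2 := by
      calc (L : ℝ) * dist (curve i j q h (code x : ℕ)) (y ⟨code x, hlt⟩)
          ≤ L * (ε / (2 * (L + 1))) := by gcongr
        _ = L / (L + 1) * (ε / 2) := by field_simp
        _ ≤ 1 * (ε / 2) := by
          gcongr
          rw [div_le_one (by positivity)]
          linarith
        _ = ε / 2 := one_mul _
    rw [dist_eq_norm] at h6
    have h8 := norm_sub_le_norm_sub_add_norm_sub (F x) (g (y ⟨code x, hlt⟩))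
      (g (curve i j q h (code x : ℕ)))
    rw [norm_sub_rev (g (y _))] at h8
    linarith

/-! ### Passage to `L^p` -/

theorem tendsto_eLpNorm_of_bounded {α : Type*} [MeasurableSpace α] {μ : Measure α}
    [IsFiniteMeasure μ] {p : ℝ≥0∞} (hp : 1 ≤ p) (hp' : p ≠ ∞) {v : ℕ → α → ℝ} {C : ℝ}
    (hv : ∀ n, AEStronglyMeasurable (v n) μ) (hC : ∀ n, ∀ᵐ x ∂μ, ‖v n x‖ ≤ C)
    (hlim : ∀ᵐ x ∂μ, Filter.Tendsto (fun n => v n x) Filter.atTop (nhds 0)) :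
    Filter.Tendsto (fun n => eLpNorm (v n) p μ) Filter.atTop (nhds 0) := by
  have hp0 : p ≠ 0 := (zero_lt_one.trans_le hp).ne'
  have hpr : 0 < p.toReal := ENNReal.toReal_pos hp0 hp'
  have h0 : Filter.Tendsto (fun n => ∫⁻ x, ‖v n x‖ₑ ^ p.toReal ∂μ) Filter.atTop
      (nhds (∫⁻ _, 0 ∂μ)) := by
    refine tendsto_lintegral_of_dominated_convergence' (fun _ => ENNReal.ofReal C ^ p.toReal)
      (fun n => (hv n).enorm.pow_const _) (fun n => ?_) ?_ ?_
    · filter_upwards [hC n] with x hx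
      gcongr
      rw [← ofReal_norm]
      exact ENNReal.ofReal_le_ofReal hx
    · rw [lintegral_const]
      exact (ENNReal.mul_lt_top (ENNReal.rpow_lt_top_of_nonneg hpr.le ENNReal.ofReal_ne_top)
        (measure_lt_top μ _)).ne
    · filter_upwards [hlim] with x hx
      have := (ENNReal.continuous_rpow_const (y := p.toReal)).tendsto 0
      rw [ENNReal.zero_rpow_of_pos hpr] at this
      refine this.comp ?_
      simpa using hx.enorm
  simp only [eLpNorm_eq_lintegral_rpow_enorm_toReal hp0 hp']
  have h1 := (ENNReal.continuous_rpow_const (y := 1 / p.toReal)).tendsto 0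
  rw [ENNReal.zero_rpow_of_pos (by positivity)] at h1
  rw [lintegral_zero] at h0
  exact h1.comp h0

end CTResNet

theorem mainTheorem7 (d m : ℕ) (hd : 2 ≤ d)
    (σ : ℝ → ℝ) (hσLip : ∃ L, LipschitzWith L σ) (hσ : ¬ CTResNet.IsAffine σ)
    (𝒢 : Set (EuclideanSpace ℝ (Fin d) → EuclideanSpace ℝ (Fin m)))
    (h𝒢 : ∀ g ∈ 𝒢, ∃ L, LipschitzWith L g)
    (F : EuclideanSpace ℝ (Fin d) → EuclideanSpace ℝ (Fin m)) (hF : Continuous F)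
    (hcover : ∀ K : Set (EuclideanSpace ℝ (Fin d)), IsCompact K →
      ∃ g ∈ 𝒢, F '' K ⊆ Set.range g) :
    ∀ K : Set (EuclideanSpace ℝ (Fin d)), IsCompact K →
      ∀ ε : ℝ, 0 < ε → ∀ p : ℝ≥0∞, 1 ≤ p → p ≠ ∞ →
        ∃ φ ∈ CTResNet.attainableSet (CTResNet.controlFamily d σ), ∃ g ∈ 𝒢,
          eLpNorm (fun x => F x - g (φ x)) p (volume.restrict K) < ENNReal.ofReal ε := by
  intro K hK ε hε p hp hp'
  obtain ⟨g, hg𝒢, hgK⟩ := hcover K hK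
  obtain ⟨L, hL⟩ := h𝒢 g hg𝒢
  set μ := volume.restrict K
  have : IsFiniteMeasure μ := isFiniteMeasure_restrict.2 hK.measure_lt_top.ne
  obtain ⟨η, hη, hηlt⟩ : ∃ η : ℝ, 0 < η ∧
      eLpNorm (fun _ : EuclideanSpace ℝ (Fin d) => 2 * η) p μ < ENNReal.ofReal (ε / 2) := by
    have hlim := CTResNet.tendsto_eLpNorm_of_bounded (μ := μ) hp hp'
      (v := fun n _ => 2 * (1 / ((n : ℝ) + 1))) (C := 2) (fun n => aestronglyMeasurable_const)
      (fun n => Filter.Eventually.of_forall fun x => ?_) (Filter.Eventually.of_forall fun x => ?_)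
    · obtain ⟨n, hn⟩ := (hlim.eventually_lt_const
        (ENNReal.ofReal_pos.2 (half_pos hε))).exists
      exact ⟨_, by positivity, hn⟩
    · rw [Real.norm_of_nonneg (by positivity)]
      have : 1 / ((n : ℝ) + 1) ≤ 1 := by
        rw [div_le_one (by positivity)]
        linarith [(Nat.cast_nonneg n : (0 : ℝ) ≤ n)]
      linarith
    · simpa using (tendsto_one_div_add_atTop_nhds_zero_nat (𝕜 := ℝ)).const_mul 2
  obtain ⟨Φ, C, hΦ, hC, hev⟩ := CTResNet.exists_bounded_approximation hd hσLip hσ hL hF hK hgK hη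
  -- The error is only eventually at most `η`, so its excess over `η` is what tends to `0`. The
  -- second `η` in the final bound pays for replacing `Φ n` by an attainable `φ`.
  set v : ℕ → EuclideanSpace ℝ (Fin d) → ℝ := fun n x => max 0 (‖F x - g (Φ n x)‖ - η)
  have hvc : ∀ n, Continuous (v n) := fun n =>
    continuous_const.max ((hF.sub (hL.continuous.comp (hΦ n).1)).norm.sub continuous_const)
  have hKm : MeasurableSet K := hK.measurableSet
  have hlim := CTResNet.tendsto_eLpNorm_of_bounded (μ := μ) hp hp' (v := v) (C := |C|)
    (fun n => (hvc n).aestronglyMeasurable)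
    (fun n => (ae_restrict_mem hKm).mono fun x hx => by
      rw [Real.norm_of_nonneg (le_max_left _ _)]
      exact max_le (abs_nonneg _) (by linarith [hC n x hx, le_abs_self C]))
    ((ae_restrict_mem hKm).mono fun x hx => by
      refine tendsto_const_nhds.congr' ?_
      filter_upwards [hev x hx] with n hn
      exact (max_eq_left (by linarith)).symm)
  obtain ⟨n, hn⟩ := (hlim.eventually_lt_const (ENNReal.ofReal_pos.2 (half_pos hε))).exists
  obtain ⟨φ, hφ, hφΦ⟩ := (hΦ n).2 K hK (η / (L + 1)) (by positivity)
  refine ⟨φ, hφ, g, hg𝒢, ?_⟩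
  calc eLpNorm (fun x => F x - g (φ x)) p μ ≤ eLpNorm (v n + fun _ => 2 * η) p μ := by
        refine eLpNorm_mono_ae_real ((ae_restrict_mem hKm).mono fun x hx => ?_)
        have h1 : ‖F x - g (Φ n x)‖ - η ≤ v n x := le_max_right _ _
        have h2 := hL.dist_le_mul (φ x) (Φ n x)
        have h3 : (L : ℝ) * dist (φ x) (Φ n x) ≤ η := by
          calc (L : ℝ) * dist (φ x) (Φ n x) ≤ L * (η / (L + 1)) := by
                gcongr
                exact (hφΦ x hx).le
            _ = L / (L + 1) * η := by field_simp
            _ ≤ 1 * η := by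
              gcongr
              rw [div_le_one (by positivity)]
              linarith
            _ = η := one_mul _
        have h4 := norm_sub_le_norm_sub_add_norm_sub (F x) (g (Φ n x)) (g (φ x))
        rw [dist_eq_norm, norm_sub_rev] at h2
        simp only [Pi.add_apply]
        linarith
    _ ≤ eLpNorm (v n) p μ + eLpNorm (fun _ => 2 * η) p μ :=
        eLpNorm_add_le (hvc n).aestronglyMeasurable aestronglyMeasurable_const hp
    _ < ENNReal.ofReal (ε / 2) + ENNReal.ofReal (ε / 2) := ENNReal.add_lt_add hn hηlt
    _ = ENNReal.ofReal ε := by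
        rw [← ENNReal.ofReal_add (by positivity) (by positivity), add_halves]
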